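/- Base stations (BSs) are placed at the points of a homogeneous Poisson point process $\Phi$ of intensity $\lambda\in(0,\infty)$ in the Euclidean plane. For $x\in\Phi$ let $\mathcal C_x=\{z:\|z-x\|\le\|z-w\|\ \forall w\in\Phi\setminus\{x\}\}$ be its Voronoi cell, for $y\in\Phi\setminus\{x\}$ let $\mathcal V^2_{x,y}=\{z:\|z-x\|\le\|z-w\|\text{ and }\|z-y\|\le\|z-w\|\ \forall w\in\Phi\setminus\{x,y\}\}$ be the second-order Voronoi cell, and let $\mathcal C^{\mathrm E}_x=\bigcup_{y\in\Phi\setminus\{x\}}\mathcal V^2_{x,y}$ and $\mathcal C^{\mathrm N}_x=\mathcal C^{\mathrm E}_x\setminus\mathcal C_x$ be the extended cell and the cell neighborhood of $x$. For a point process $\Psi$ of users (UEs), let $K_x=\#(\Psi\cap\mathcal C_x)$ be the number of UEs of the BS $x$, and $K'_x=\#(\Psi\cap\mathcal C^{\mathrm N}_x)$ the number of its neighboring UEs, i.e. of those for which $x$ is the second closest BS. Let $\mathbb E^0$ be the expectation for the typical BS under the Palm probability of $\Phi$, i.e. $\mathbb E^0[f]=\mathbb E\big[\sum_{x\in\Phi\cap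 B}f_x\big]\big/\,\mathbb E[\#(\Phi\cap B)]$ for any Borel set $B$ with $0<|B|<\infty$. Then: 1. $\mathbb E^0|\mathcal C|=1/\lambda$ and $\mathbb E^0|\mathcal C^{\mathrm E}|=2\,\mathbb E^0|\mathcal C|$, where $|\cdot|$ is the Lebesgue measure. 2. If $\Psi$ is a homogeneous Poisson point process of intensity $\lambda_{\mathrm u}\ge 0$ independent of $\Phi$, then the mean number of UEs per BS is $\mathbb E^0[K_\bullet]=\lambda_{\mathrm u}/\lambda=:K$, and $\mathbb E^0[K'_\bullet]=K$. 3. If $\Psi$ is any point process of scheduled UEs such that $(\Phi,\Psi)$ is jointly stationary and almost surely no UE is equidistant from two BSs, then $\mathbb E^0[K'_\bullet]=\mathbb E^0[K_\bullet]$ (in $[0,\infty]$). In particular, if almost surely every cell contains exactly $K$ scheduled UEs, $K\in\{0,1,2,\dots\}$, then $\mathbb E^0[K'_\bullet]=K$. -/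

import Mathlib

open MeasureTheory ProbabilityTheory
open scoped ENNReal NNReal

/-- The Euclidean plane. -/
abbrev Plane : Type := EuclideanSpace ℝ (Fin 2)

namespace Network

/-! ### Voronoi cells of a configuration `φ` of base stations -/

/-- The first-order Voronoi cell of the station `x`. -/
def cell (φ : Set Plane) (x : Plane) : Set Plane :=
  {z | ∀ w ∈ φ \ {x}, ‖z - x‖ ≤ ‖z - w‖}

/-- The second-order Voronoi cell of the pair of stations `x`, `y`. -/
def secondOrderCell (φ : Set Plane) (x y : Plane) : Set Plane :=
  {z | ∀ l ∈ ({x, y} : Set Plane), ∀ w ∈ φ \ {x, y}, ‖z - l‖ ≤ ‖z - w‖}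

/-- The extended cell of the station `x`: the union of its second-order cells. -/
def extendedCell (φ : Set Plane) (x : Plane) : Set Plane :=
  ⋃ y ∈ φ \ {x}, secondOrderCell φ x y

/-- The cell neighborhood of the station `x`. -/
def neighborhood (φ : Set Plane) (x : Plane) : Set Plane :=
  extendedCell φ x \ cell φ x

/-! ### Point processes in the plane -/

variable {Ω : Type*} [MeasurableSpace Ω]

/-- The number of points of `Φ` in `B`. -/
noncomputable def numPoints (Φ : Ω → Set Plane) (B : Set Plane) (ω : Ω) : ℕ∞ :=
  (Φ ω ∩ B).encard

/-- A (simple) point process in the plane: a random locally finite set of points. -/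
structure IsPointProcess (Φ : Ω → Set Plane) : Prop where
  locallyFinite : ∀ (ω : Ω) (B : Set Plane), Bornology.IsBounded B → (Φ ω ∩ B).Finite
  measurable : ∀ B : Set Plane, MeasurableSet B → Measurable (numPoints Φ B)

/-- A homogeneous Poisson point process of intensity `r`. -/
structure IsPoissonProcess (Φ : Ω → Set Plane) (r : ℝ≥0) (P : Measure Ω) : Prop
    extends IsPointProcess Φ where
  law : ∀ B : Set Plane, MeasurableSet B → volume B ≠ ∞ →
    P.map (numPoints Φ B) =
      (poissonMeasure (r * (volume B).toNNReal)).map (fun n : ℕ => (n : ℕ∞))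
  indep : ∀ (n : ℕ) (B : Fin n → Set Plane), (∀ i, MeasurableSet (B i)) →
    Pairwise (fun i j => Disjoint (B i) (B j)) → iIndepFun (fun i => numPoints Φ (B i)) P

/-- The σ-algebra on `Ω` generated by the numbers of points of `Φ` in the Borel sets. -/
@[reducible]
noncomputable def sigmaAlgebra (Φ : Ω → Set Plane) : MeasurableSpace Ω :=
  ⨆ (B : Set Plane) (_ : MeasurableSet B), MeasurableSpace.comap (numPoints Φ B) inferInstance

/-- The two point processes are independent of each other. -/
def Independent (Φ Ψ : Ω → Set Plane) (P : Measure Ω) : Prop :=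
  Indep (sigmaAlgebra Φ) (sigmaAlgebra Ψ) P

/-- The counting measure of a configuration of points. -/
noncomputable def countingMeasure (φ : Set Plane) : Measure Plane :=
  Measure.count.restrict φ

/-- The two point processes are jointly stationary: their joint law is unchanged when both of them
are translated by the same vector. -/
def JointlyStationary (Φ Ψ : Ω → Set Plane) (P : Measure Ω) : Prop :=
  ∀ v : Plane, IdentDistrib
    (fun ω => (countingMeasure ((fun z => v + z) '' Φ ω),
      countingMeasure ((fun z => v + z) '' Ψ ω)))
    (fun ω => (countingMeasure (Φ ω), countingMeasure (Ψ ω))) P P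

/-- The expectation of the quantity `f` at the typical point of `Φ`, that is, its expectation under
the Palm probability of `Φ`, computed with the window `B`: the expected sum of `f` over the points
of `Φ` in `B`, divided by the expected number of these points. -/
noncomputable def palmMean (P : Measure Ω) (Φ : Ω → Set Plane) (B : Set Plane)
    (f : Ω → Plane → ℝ≥0∞) : ℝ≥0∞ :=
  (∫⁻ ω, ∑' x : ↥(Φ ω ∩ B), f ω (x : Plane) ∂P) / ∫⁻ ω, (numPoints Φ B ω : ℝ≥0∞) ∂P

/-! ### Users (UEs) of a base station -/

/-- The number of users in the cell of the station `x`. -/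
noncomputable def numUsers (Φ Ψ : Ω → Set Plane) (ω : Ω) (x : Plane) : ℕ∞ :=
  (Ψ ω ∩ cell (Φ ω) x).encard

/-- The number `K'` of neighboring users of the station `x`: the users in its cell
neighborhood. -/
noncomputable def numNeighbors (Φ Ψ : Ω → Set Plane) (ω : Ω) (x : Plane) : ℕ∞ :=
  (Ψ ω ∩ neighborhood (Φ ω) x).encard

end Network

/-! Say that a station has rank `k` for a location when exactly `k` stations are strictly closer.
The cell of `x` is the set where `x` has rank 0. As soon as there are two stations, which happens
almost surely (`IsPoissonProcess.ae_nontrivial`), the neighborhood is exactly the set where `x` has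
rank 1, and the extended cell is the disjoint union of the two (`extendedCell_eq_union`,
`neighborhood_eq_rankCell`). All claims thus say that ranks 0 and 1 have the same mean.

For areas, Fubini turns the expected total area of the rank-`k` sets of the stations in `B` into an
integral over `z` of the expected number of stations in `B` of rank `k` for `z`. By a Mecke formula
(`IsPoissonProcess.lintegral_rankIndicator_station`) a station at `x` contributes `r` times the
Poisson probability of `k` points in the disc around `z` through `x`. The integral of this
probability over the plane is `1 / r` for every `k`, a Gamma integral (`lintegral_discMass_norm`),
so the total is the area of `B`. Dividing by the mean number `r * volume B` of stations in `B` gives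
`1 / r`. For independent Poisson users, freezing the stations and averaging over the users replaces
counts by `ru` times areas (`IsPoissonProcess.lintegral_countingMeasure_rankCell`).

For stationary users no explicit law is available, and mass transport replaces it
(`JointlyStationary.mass_transport`): if each user sends unit mass to its station of rank `k`, the
mean mass received in `B` equals the mean mass sent from `B`. Without ties a user has exactly one
station of rank 0 and one of rank 1 (`existsUnique_mem_rankCell`), so the mass sent is the mean
number of users in `B` for both ranks. -/

namespace Network

/-! ### Locally finite kernels -/

/-- A finite mass at each parameter need not be uniformly bounded; splitting the parameter space by
the integer part of the mass gives countably many pieces with a uniform bound. -/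
theorem isSFiniteKernel_of_measure_univ_lt_top {α β : Type*} [MeasurableSpace α]
    [MeasurableSpace β] (κ : Kernel α β) (h : ∀ a, κ a Set.univ < ∞) : IsSFiniteKernel κ := by
  classical
  set g : α → ℕ := fun a => ⌊(κ a Set.univ).toNNReal⌋₊ with hg
  have hgm : Measurable g :=
    Nat.measurable_floor.comp (κ.measurable_coe MeasurableSet.univ).ennreal_toNNReal
  have hs (m : ℕ) : MeasurableSet (g ⁻¹' {m}) := hgm (measurableSet_singleton m)
  have hκ : κ = Kernel.sum fun m => Kernel.piecewise (hs m) κ 0 := by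
    ext a s hs'
    rw [Kernel.sum_apply, Measure.sum_apply _ hs', tsum_eq_single (g a)]
    · simp [Kernel.piecewise_apply]
    · intro m hm
      simp [Kernel.piecewise_apply, hm.symm]
  rw [hκ]
  refine Kernel.isSFiniteKernel_sum (hκs := fun m => ?_)
  have : IsFiniteKernel (Kernel.piecewise (hs m) κ 0) := by
    refine ⟨⟨(m : ℝ≥0∞) + 1, by finiteness, fun a => ?_⟩⟩
    rw [Kernel.piecewise_apply]
    split_ifs with ha
    · have h1 := (Nat.lt_floor_add_one (κ a Set.univ).toNNReal).le
      rw [show ⌊(κ a Set.univ).toNNReal⌋₊ = m from ha] at h1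
      rw [← ENNReal.coe_toNNReal (h a).ne]
      exact_mod_cast h1
    · simp
  infer_instance

theorem isSFiniteKernel_of_iUnion_eq_univ {α β : Type*} [MeasurableSpace α]
    [MeasurableSpace β] (κ : Kernel α β) (A : ℕ → Set β) (hA : ∀ n, MeasurableSet (A n))
    (hU : ⋃ n, A n = Set.univ) (h : ∀ a n, κ a (A n) < ∞) : IsSFiniteKernel κ := by
  have hD (n : ℕ) : MeasurableSet (disjointed A n) := MeasurableSet.disjointed hA n
  have hκ : κ = Kernel.sum fun n => κ.restrict (hD n) := by
    ext a : 1
    rw [Kernel.sum_apply]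
    simp only [Kernel.restrict_apply]
    rw [← Measure.restrict_iUnion (disjoint_disjointed A) hD, iUnion_disjointed, hU,
      Measure.restrict_univ]
  rw [hκ]
  refine Kernel.isSFiniteKernel_sum
    (hκs := fun n => isSFiniteKernel_of_measure_univ_lt_top _ fun a => ?_)
  rw [Kernel.restrict_apply, Measure.restrict_apply_univ]
  exact (measure_mono (disjointed_subset A n)).trans_lt (h a n)

/-- The locally finite measures on the plane. -/
def locallyFinite : Set (Measure Plane) :=
  {μ | ∀ n : ℕ, μ (Metric.ball 0 n) < ∞}

theorem measurableSet_locallyFinite : MeasurableSet locallyFinite := by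
  have : locallyFinite = ⋂ n : ℕ, {μ : Measure Plane | μ (Metric.ball 0 n) < ∞} := by
    ext; simp [locallyFinite]
  rw [this]
  exact MeasurableSet.iInter fun n =>
    measurableSet_lt (Measure.measurable_coe Metric.isOpen_ball.measurableSet) measurable_const

open Classical in
/-- The kernel that maps a locally finite measure to itself, and any other measure to zero. -/
noncomputable def locallyFinitePart : Kernel (Measure Plane) Plane :=
  Kernel.piecewise measurableSet_locallyFinite ⟨id, measurable_id⟩ 0

theorem locallyFinitePart_eq {μ : Measure Plane} (h : μ ∈ locallyFinite) :
    locallyFinitePart μ = μ := by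
  classical
  rw [locallyFinitePart, Kernel.piecewise_apply, if_pos h]
  rfl

/-- S-finiteness is what makes integrals against a random configuration measurable in the
configuration and allows Fubini; cutting off to measures finite on balls secures it. -/
instance : IsSFiniteKernel locallyFinitePart := by
  classical
  refine isSFiniteKernel_of_iUnion_eq_univ _ (fun n : ℕ => Metric.ball (0 : Plane) n)
    (fun n => Metric.isOpen_ball.measurableSet) (Metric.iUnion_ball_nat 0) fun μ n => ?_
  rw [locallyFinitePart, Kernel.piecewise_apply]
  split_ifs with h
  · exact h n
  · simp

/-! ### Ranks and the transport functional on pairs of measures. -/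

/-- The triples `(μ, x, z)` such that `μ` has mass `k` in the open disc around `z` through `x`. -/
def rankSet (k : ℕ) : Set (Measure Plane × Plane × Plane) :=
  {p | locallyFinitePart p.1 (Metric.ball p.2.2 (dist p.2.1 p.2.2)) = k}

theorem measurableSet_rankSet (k : ℕ) : MeasurableSet (rankSet k) := by
  have hb : MeasurableSet {q : (Measure Plane × Plane × Plane) × Plane |
      q.2 ∈ Metric.ball q.1.2.2 (dist q.1.2.1 q.1.2.2)} := by
    simp only [Metric.mem_ball]
    exact measurableSet_lt (by fun_prop) (by fun_prop)
  have hm := Kernel.measurable_kernel_prodMk_left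
    (κ := locallyFinitePart.comap (Prod.fst : Measure Plane × Plane × Plane → _) measurable_fst) hb
  exact hm (measurableSet_singleton (k : ℝ≥0∞))

/-- The indicator of `rankSet k`. -/
noncomputable def rankIndicator (k : ℕ) : Measure Plane × Plane × Plane → ℝ≥0∞ :=
  (rankSet k).indicator 1

@[fun_prop]
theorem measurable_rankIndicator (k : ℕ) : Measurable (rankIndicator k) :=
  measurable_one.indicator (measurableSet_rankSet k)

theorem measurable_lintegral_locallyFinitePart {α : Type*} [MeasurableSpace α]
    {g : α → Measure Plane} (hg : Measurable g) {f : α → Plane → ℝ≥0∞}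
    (hf : Measurable (Function.uncurry f)) :
    Measurable fun a => ∫⁻ x, f a x ∂locallyFinitePart (g a) :=
  Measurable.lintegral_kernel_prod_right (κ := locallyFinitePart.comap g hg) hf

/-- The total mass of the pairs of a point `x` of `p.1` and a point `z` of `p.2` for which `x` has
rank `k`, where the pair has the weight `f x * g z`. -/
noncomputable def transport (k : ℕ) (f g : Plane → ℝ≥0∞) (p : Measure Plane × Measure Plane) :
    ℝ≥0∞ :=
  ∫⁻ x, ∫⁻ z, f x * g z * rankIndicator k (p.1, x, z) ∂locallyFinitePart p.2
    ∂locallyFinitePart p.1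

theorem measurable_transport {α : Type*} [MeasurableSpace α] (k : ℕ) {f g : α → Plane → ℝ≥0∞}
    (hf : Measurable (Function.uncurry f)) (hg : Measurable (Function.uncurry g))
    {p : α → Measure Plane × Measure Plane} (hp : Measurable p) :
    Measurable fun a => transport k (f a) (g a) (p a) := by
  unfold transport
  refine measurable_lintegral_locallyFinitePart (by fun_prop) ?_
  refine measurable_lintegral_locallyFinitePart (by fun_prop) ?_
  have h1 : Measurable fun q : (α × Plane) × Plane => f q.1.1 q.1.2 := hf.comp measurable_fst
  have h2 : Measurable fun q : (α × Plane) × Plane => g q.1.1 q.2 :=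
    hg.comp ((measurable_fst.comp measurable_fst).prodMk measurable_snd)
  exact (h1.mul h2).mul (by fun_prop)

/-- Tonelli: averaging over a family of weights acts on the weights alone, since the rank does not
depend on `v`. Used with translated windows in the mass transport argument. -/
theorem lintegral_transport (k : ℕ) {f g : Plane → Plane → ℝ≥0∞}
    (hf : Measurable (Function.uncurry f)) (hg : Measurable (Function.uncurry g))
    (p : Measure Plane × Measure Plane) :
    ∫⁻ v, transport k (f v) (g v) p =
      ∫⁻ x, ∫⁻ z, (∫⁻ v, f v x * g v z) * rankIndicator k (p.1, x, z) ∂locallyFinitePart p.2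
        ∂locallyFinitePart p.1 := by
  unfold transport
  have h1 : Measurable fun q : (Plane × Plane) × Plane => f q.1.1 q.1.2 := hf.comp measurable_fst
  have h2 : Measurable fun q : (Plane × Plane) × Plane => g q.1.1 q.2 :=
    hg.comp ((measurable_fst.comp measurable_fst).prodMk measurable_snd)
  have h3 : Measurable fun q : (Plane × Plane) × Plane =>
      f q.1.1 q.1.2 * g q.1.1 q.2 * rankIndicator k (p.1, q.1.2, q.2) :=
    (h1.mul h2).mul (by fun_prop)
  rw [lintegral_lintegral_swap (Measurable.lintegral_prod_right h3).aemeasurable]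
  refine lintegral_congr fun x => ?_
  have h4 : Measurable fun q : Plane × Plane =>
      f q.1 x * g q.1 q.2 * rankIndicator k (p.1, x, q.2) :=
    h3.comp (by fun_prop : Measurable fun q : Plane × Plane => ((q.1, x), q.2))
  rw [lintegral_lintegral_swap h4.aemeasurable]
  refine lintegral_congr fun z => lintegral_mul_const _ ?_
  exact (hf.comp (measurable_id.prodMk measurable_const)).mul
    (hg.comp (measurable_id.prodMk measurable_const))

/-! ### Locally finite configurations and their counting measures -/

section Configuration

variable {φ : Set Plane}

theorem countable_of_finite_inter (hφ : ∀ B : Set Plane, Bornology.IsBounded B → (φ ∩ B).Finite) :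
    φ.Countable := by
  rw [← Set.inter_univ φ, ← Metric.iUnion_ball_nat (0 : Plane), Set.inter_iUnion]
  exact Set.countable_iUnion fun n => (hφ _ Metric.isBounded_ball).countable

theorem countingMeasure_apply (hφ : φ.Countable) {B : Set Plane} (hB : MeasurableSet B) :
    countingMeasure φ B = ((φ ∩ B).encard : ℝ≥0∞) := by
  rw [countingMeasure, Measure.restrict_apply hB, Set.inter_comm,
    Measure.count_apply (hφ.measurableSet.inter hB)]

theorem countingMeasure_mem_locallyFinite
    (hφ : ∀ B : Set Plane, Bornology.IsBounded B → (φ ∩ B).Finite) :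
    countingMeasure φ ∈ locallyFinite := by
  intro n
  rw [countingMeasure_apply (countable_of_finite_inter hφ) Metric.isOpen_ball.measurableSet]
  simpa [lt_top_iff_ne_top] using hφ _ Metric.isBounded_ball

theorem setLIntegral_countingMeasure (hφ : φ.Countable) {B : Set Plane} (hB : MeasurableSet B)
    (f : Plane → ℝ≥0∞) :
    ∫⁻ x in B, f x ∂countingMeasure φ = ∑' x : ↥(φ ∩ B), f x := by
  rw [countingMeasure, Measure.restrict_restrict hB, Set.inter_comm,
    lintegral_countable _ (hφ.mono Set.inter_subset_left)]
  simp

theorem map_countingMeasure_vadd (hφ : φ.Countable) (v : Plane) :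
    countingMeasure ((fun z => v + z) '' φ) = (countingMeasure φ).map (fun z => v + z) := by
  ext B hB
  rw [countingMeasure_apply (hφ.image _) hB, Measure.map_apply (measurable_const_add v) hB,
    countingMeasure_apply hφ (measurable_const_add v hB), ← Set.image_inter_preimage,
    (add_right_injective v).encard_image]

/-- Only the finitely many points no farther from `z` than a given one compete for the minimum. -/
theorem exists_forall_dist_le (hφ : ∀ B : Set Plane, Bornology.IsBounded B → (φ ∩ B).Finite)
    {S : Set Plane} (hS : S ⊆ φ) (hne : S.Nonempty) (z : Plane) :
    ∃ y ∈ S, ∀ w ∈ S, dist y z ≤ dist w z := by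
  obtain ⟨s, hs⟩ := hne
  have hfin : (S ∩ Metric.closedBall z (dist s z)).Finite :=
    (hφ _ Metric.isBounded_closedBall).subset (Set.inter_subset_inter_left _ hS)
  obtain ⟨y, hy, hmin⟩ := Set.exists_min_image _ (fun w => dist w z) hfin ⟨s, hs, by simp⟩
  refine ⟨y, hy.1, fun w hw => ?_⟩
  by_cases h : dist w z ≤ dist s z
  · exact hmin w ⟨hw, h⟩
  · exact (hmin s ⟨hs, by simp⟩).trans (not_le.1 h).le

/-- The locations that have exactly `k` stations closer than `x`. -/
def rankCell (k : ℕ) (φ : Set Plane) (x : Plane) : Set Plane :=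
  {z | (φ ∩ Metric.ball z (dist x z)).encard = k}

theorem disjoint_rankCell {k l : ℕ} (h : k ≠ l) (φ : Set Plane) (x : Plane) :
    Disjoint (rankCell k φ x) (rankCell l φ x) :=
  Set.disjoint_left.2 fun z hk hl => h <| by
    have hk' : (φ ∩ Metric.ball z (dist x z)).encard = k := hk
    rw [show (φ ∩ Metric.ball z (dist x z)).encard = l from hl] at hk'
    exact_mod_cast hk'.symm

theorem rankIndicator_countingMeasure
    (hφ : ∀ B : Set Plane, Bornology.IsBounded B → (φ ∩ B).Finite) (k : ℕ) (x z : Plane) :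
    rankIndicator k (countingMeasure φ, x, z) = (rankCell k φ x).indicator 1 z := by
  have : (countingMeasure φ, x, z) ∈ rankSet k ↔ z ∈ rankCell k φ x := by
    rw [rankSet, Set.mem_ofPred_eq, locallyFinitePart_eq (countingMeasure_mem_locallyFinite hφ),
      countingMeasure_apply (countable_of_finite_inter hφ) Metric.isOpen_ball.measurableSet,
      rankCell, Set.mem_ofPred_eq]
    norm_cast
  by_cases h : z ∈ rankCell k φ x
  · rw [rankIndicator, Set.indicator_of_mem (this.2 h), Set.indicator_of_mem h, Pi.one_apply,
      Pi.one_apply]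
  · rw [rankIndicator, Set.indicator_of_notMem (this.not.2 h), Set.indicator_of_notMem h]

theorem measurableSet_rankCell
    (hφ : ∀ B : Set Plane, Bornology.IsBounded B → (φ ∩ B).Finite) (k : ℕ) (x : Plane) :
    MeasurableSet (rankCell k φ x) := by
  have h : Measurable fun z => rankIndicator k (countingMeasure φ, x, z) := by fun_prop
  simp_rw [rankIndicator_countingMeasure hφ] at h
  exact (measurable_indicator_const_iff (1 : ℝ≥0∞)).1 h

theorem lintegral_rankIndicator
    (hφ : ∀ B : Set Plane, Bornology.IsBounded B → (φ ∩ B).Finite) (k : ℕ) (x : Plane)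
    (ν : Measure Plane) :
    ∫⁻ z, rankIndicator k (countingMeasure φ, x, z) ∂ν = ν (rankCell k φ x) := by
  simp_rw [rankIndicator_countingMeasure hφ]
  exact lintegral_indicator_one (measurableSet_rankCell hφ k x)

theorem cell_eq_rankCell (φ : Set Plane) (x : Plane) : cell φ x = rankCell 0 φ x := by
  ext z
  simp only [cell, rankCell, Set.mem_ofPred_eq, Nat.cast_zero, Set.encard_eq_zero,
    Set.eq_empty_iff_forall_notMem, Set.mem_inter_iff, Metric.mem_ball, not_and, not_lt,
    Set.mem_sdiff, Set.mem_singleton_iff, dist_eq_norm, norm_sub_rev _ z]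
  refine ⟨fun h w hw => ?_, fun h w hw => h w hw.1⟩
  by_cases hwx : w = x
  · rw [hwx]
  · exact h w ⟨hw, hwx⟩

/-- Being one of the two closest stations means that at most one station is strictly closer. The
companion `y` is that station for rank 1, and a nearest other station for rank 0. With `x` as the
only station there is no `y`: the extended cell is empty while the rank-0 set is everything, hence
`hnt`. -/
theorem extendedCell_eq_union
    (hφ : ∀ B : Set Plane, Bornology.IsBounded B → (φ ∩ B).Finite) (hnt : φ.Nontrivial)
    (x : Plane) : extendedCell φ x = rankCell 0 φ x ∪ rankCell 1 φ x := by
  ext z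
  have key : z ∈ extendedCell φ x ↔ ∃ y ∈ φ \ {x}, ∀ w ∈ φ \ {x, y},
      dist x z ≤ dist w z ∧ dist y z ≤ dist w z := by
    simp only [extendedCell, secondOrderCell, Set.mem_iUnion, exists_prop, Set.mem_ofPred_eq,
      Set.mem_insert_iff, Set.mem_singleton_iff, forall_eq_or_imp, forall_eq, dist_eq_norm,
      norm_sub_rev _ z]
    refine exists_congr fun y => and_congr_right fun _ => ?_
    exact ⟨fun h w hw => ⟨h.1 w hw, h.2 w hw⟩,
      fun h => ⟨fun w hw => (h w hw).1, fun w hw => (h w hw).2⟩⟩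
  rw [key, Set.mem_union, rankCell, rankCell, Set.mem_ofPred_eq, Set.mem_ofPred_eq, Nat.cast_zero,
    Nat.cast_one, Set.encard_eq_zero, Set.encard_eq_one]
  constructor
  · rintro ⟨y, -, h⟩
    suffices hsub : φ ∩ Metric.ball z (dist x z) ⊆ {y} from
      (Set.subset_singleton_iff_eq.1 hsub).imp_right fun h => ⟨y, h⟩
    intro w hw
    by_contra hwy
    have hwx : w ≠ x := by
      rintro rfl
      simpa using hw.2
    exact (h w ⟨hw.1, by simp_all⟩).1.not_gt hw.2
  · rintro (h | ⟨y, h⟩)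
    · obtain ⟨y, hy, hmin⟩ := exists_forall_dist_le hφ (S := φ \ {x}) Set.sdiff_subset
        (by obtain ⟨y, hy, hyx⟩ := hnt.exists_ne x; exact ⟨y, hy, hyx⟩) z
      refine ⟨y, hy, fun w hw => ⟨?_, hmin w ⟨hw.1, fun h' => hw.2 (Or.inl h')⟩⟩⟩
      by_contra hlt
      exact Set.eq_empty_iff_forall_notMem.1 h w ⟨hw.1, not_le.1 hlt⟩
    · have hy : y ∈ φ ∩ Metric.ball z (dist x z) := h ▸ rfl
      refine ⟨y, ⟨hy.1, ?_⟩, fun w hw => ?_⟩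
      · rintro rfl
        simpa using hy.2
      · have hle : dist x z ≤ dist w z := by
          by_contra hlt
          have : w ∈ φ ∩ Metric.ball z (dist x z) := ⟨hw.1, not_le.1 hlt⟩
          rw [h] at this
          exact hw.2 (Or.inr this)
        exact ⟨hle, (Metric.mem_ball.1 hy.2).le.trans hle⟩

theorem neighborhood_eq_rankCell
    (hφ : ∀ B : Set Plane, Bornology.IsBounded B → (φ ∩ B).Finite) (hnt : φ.Nontrivial)
    (x : Plane) : neighborhood φ x = rankCell 1 φ x := by
  rw [neighborhood, extendedCell_eq_union hφ hnt, cell_eq_rankCell, Set.union_sdiff_left,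
    (disjoint_rankCell one_ne_zero φ x).sdiff_eq_left]

/-- Without ties there is exactly one closest station, and exactly one second closest station. -/
theorem existsUnique_mem_rankCell
    (hφ : ∀ B : Set Plane, Bornology.IsBounded B → (φ ∩ B).Finite) (hnt : φ.Nontrivial)
    {z : Plane} (hz : Set.InjOn (fun x => ‖z - x‖) φ) {k : ℕ} (hk : k ≤ 1) :
    ∃! x, x ∈ φ ∧ z ∈ rankCell k φ x := by
  have hinj : ∀ a ∈ φ, ∀ b ∈ φ, dist a z = dist b z → a = b := fun a ha b hb h =>
    hz ha hb (by simpa [dist_eq_norm, norm_sub_rev _ z] using h)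
  obtain ⟨a, ha, hamin⟩ := exists_forall_dist_le hφ subset_rfl hnt.nonempty z
  have hball : φ ∩ Metric.ball z (dist a z) = ∅ :=
    Set.eq_empty_iff_forall_notMem.2 fun w hw => (hamin w hw.1).not_gt hw.2
  interval_cases k
  · refine ⟨a, ⟨ha, by simp [rankCell, hball]⟩, ?_⟩
    rintro b ⟨hb, hbz⟩
    rw [← cell_eq_rankCell] at hbz
    by_contra hne
    refine hne (hinj b hb a ha (le_antisymm ?_ (hamin b hb)))
    simpa [dist_eq_norm, norm_sub_rev _ z] using hbz a ⟨ha, Ne.symm hne⟩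
  · obtain ⟨b, hb, hbmin⟩ := exists_forall_dist_le hφ (S := φ \ {a}) Set.sdiff_subset
      (by obtain ⟨y, hy, hya⟩ := hnt.exists_ne a; exact ⟨y, hy, hya⟩) z
    have hab : dist a z < dist b z :=
      (hamin b hb.1).lt_of_ne fun h => hb.2 (hinj a ha b hb.1 h).symm
    refine ⟨b, ⟨hb.1, ?_⟩, ?_⟩
    · rw [rankCell, Set.mem_ofPred_eq, Nat.cast_one, Set.encard_eq_one]
      refine ⟨a, Set.eq_singleton_iff_unique_mem.2 ⟨⟨ha, hab⟩, fun w hw => ?_⟩⟩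
      by_contra hne
      exact (hbmin w ⟨hw.1, hne⟩).not_gt hw.2
    · rintro c ⟨hc, hcz⟩
      rw [rankCell, Set.mem_ofPred_eq, Nat.cast_one, Set.encard_eq_one] at hcz
      obtain ⟨y, hy⟩ := hcz
      have hca : c ≠ a := by
        rintro rfl
        exact Set.singleton_ne_empty y (hy.symm.trans hball)
      -- If `c` were strictly farther than `b`, both `a` and `b` would be closer than `c`,
      -- contradicting rank 1.
      refine hinj c hc b hb.1 (le_antisymm ?_ (hbmin c ⟨hc, hca⟩))
      by_contra hlt
      have hb' : b ∈ φ ∩ Metric.ball z (dist c z) := ⟨hb.1, not_le.1 hlt⟩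
      have ha' : a ∈ φ ∩ Metric.ball z (dist c z) := ⟨ha, hab.trans (not_le.1 hlt)⟩
      rw [hy] at ha' hb'
      exact hab.ne (by rw [ha', hb'])

theorem lintegral_rankIndicator_station
    (hφ : ∀ B : Set Plane, Bornology.IsBounded B → (φ ∩ B).Finite) (hnt : φ.Nontrivial)
    {z : Plane} (hz : Set.InjOn (fun x => ‖z - x‖) φ) {k : ℕ} (hk : k ≤ 1) :
    ∫⁻ x, rankIndicator k (countingMeasure φ, x, z) ∂countingMeasure φ = 1 := by
  obtain ⟨x, ⟨hx, hxz⟩, huniq⟩ := existsUnique_mem_rankCell hφ hnt hz hk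
  rw [← setLIntegral_univ,
    setLIntegral_countingMeasure (countable_of_finite_inter hφ) MeasurableSet.univ]
  simp_rw [rankIndicator_countingMeasure hφ]
  rw [tsum_eq_single ⟨x, hx, trivial⟩]
  · simp [hxz]
  · rintro ⟨y, hy, _⟩ hne
    refine Set.indicator_of_notMem (fun h => hne ?_) _
    exact Subtype.ext (huniq y ⟨hy, h⟩)

end Configuration

/-! ### Poisson processes -/

/-- The probability that a Poisson process of intensity `r` has `k` points in a disc of
radius `ρ`. -/
noncomputable def discMass (r : ℝ≥0) (k : ℕ) (ρ : ℝ) : ℝ≥0∞ :=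
  ENNReal.ofReal (Real.exp (-(r * (Real.pi * ρ ^ 2))) * (r * (Real.pi * ρ ^ 2)) ^ k / k.factorial)

theorem continuous_discMass (r : ℝ≥0) (k : ℕ) : Continuous (discMass r k) := by
  unfold discMass
  exact ENNReal.continuous_ofReal.comp (by fun_prop)

/-- In polar coordinates with `t = b π ρ²` this is `1 / b` times the integral of `exp (-t) t ^ k /
k!`, which is 1 for every `k`. This independence of `k` is why ranks 0 and 1 have equal mean areas.
-/
theorem integral_exp_mul_pow_norm {b : ℝ} (hb : 0 < b) (k : ℕ) :
    ∫ x : Plane, Real.exp (-(b * (Real.pi * ‖x‖ ^ 2))) * (b * (Real.pi * ‖x‖ ^ 2)) ^ k /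
      k.factorial = b⁻¹ := by
  rw [integral_fun_norm_addHaar volume fun ρ =>
    Real.exp (-(b * (Real.pi * ρ ^ 2))) * (b * (Real.pi * ρ ^ 2)) ^ k / k.factorial]
  have hvol : (volume : Measure Plane).real (Metric.ball 0 1) = Real.pi := by
    simp [Measure.real, EuclideanSpace.volume_ball_fin_two, Real.pi_pos.le]
  -- The polar Jacobian adds one factor `y`, whence the exponent `2 * k + 1` and the value `Γ (k +
  -- 1) = k!`.
  have hint : ∫ y in Set.Ioi (0 : ℝ), y ^ (Module.finrank ℝ Plane - 1) •
      (Real.exp (-(b * (Real.pi * y ^ 2))) * (b * (Real.pi * y ^ 2)) ^ k / k.factorial) =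
      ((b * Real.pi) ^ k / k.factorial) *
        ∫ y in Set.Ioi (0 : ℝ), y ^ ((2 * k + 1 : ℕ) : ℝ) *
          Real.exp (-(b * Real.pi) * y ^ (2 : ℝ)) := by
    rw [← integral_const_mul]
    refine setIntegral_congr_fun measurableSet_Ioi fun y hy => ?_
    simp only [finrank_euclideanSpace, Fintype.card_fin, smul_eq_mul, Real.rpow_natCast,
      Real.rpow_two]
    ring_nf
  rw [hint, integral_rpow_mul_exp_neg_mul_rpow two_pos
    (lt_of_lt_of_le (by norm_num) (Nat.cast_nonneg _)) (by positivity), hvol]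
  have h1 : (((2 * k + 1 : ℕ) : ℝ) + 1) / 2 = k + 1 := by push_cast; ring
  have h2 : -(((2 * k + 1 : ℕ) : ℝ) + 1) / 2 = -((k + 1 : ℕ) : ℝ) := by push_cast; ring
  rw [h1, h2, Real.Gamma_nat_eq_factorial, Real.rpow_neg (by positivity), Real.rpow_natCast]
  simp only [finrank_euclideanSpace, Fintype.card_fin, nsmul_eq_mul, smul_eq_mul]
  have := Real.pi_pos
  have : (k.factorial : ℝ) ≠ 0 := by positivity
  field_simp
  push_cast
  ring

theorem lintegral_discMass_norm {r : ℝ≥0} (hr : 0 < r) (k : ℕ) :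
    ∫⁻ x : Plane, discMass r k ‖x‖ = (r : ℝ≥0∞)⁻¹ := by
  have hint := integral_exp_mul_pow_norm (NNReal.coe_pos.2 hr) k
  have hi : Integrable fun x : Plane => Real.exp (-(r * (Real.pi * ‖x‖ ^ 2))) *
      (r * (Real.pi * ‖x‖ ^ 2)) ^ k / k.factorial := by
    -- A non-integrable function would have Bochner integral 0 by convention, but the integral is a
    -- positive number.
    by_contra h
    rw [integral_undef h] at hint
    exact (inv_pos.2 (NNReal.coe_pos.2 hr)).ne hint
  unfold discMass
  rw [← ofReal_integral_eq_lintegral_ofReal hi (Filter.Eventually.of_forall fun x => by positivity),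
    hint, ENNReal.ofReal_inv_of_pos (NNReal.coe_pos.2 hr), ENNReal.ofReal_coe_nnreal]

theorem lintegral_natCast_poissonMeasure (a : ℝ≥0) :
    ∫⁻ n : ℕ, (n : ℝ≥0∞) ∂poissonMeasure a = a := by
  rw [lintegral_countable', tsum_eq_zero_add' ENNReal.summable]
  -- The size-biased Poisson weights are the weights themselves shifted by one, times `a`.
  have h (n : ℕ) : ((n + 1 : ℕ) : ℝ≥0∞) * poissonMeasure a {n + 1} = a * poissonMeasure a {n} := by
    rw [poissonMeasure_singleton, poissonMeasure_singleton, ← ENNReal.ofReal_natCast,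
      ← ENNReal.ofReal_coe_nnreal, ← ENNReal.ofReal_mul (by positivity),
      ← ENNReal.ofReal_mul (by positivity), Nat.factorial_succ]
    congr 1
    have : (n.factorial : ℝ) ≠ 0 := by positivity
    push_cast
    field_simp
    ring
  simp_rw [h]
  have hs : ∑' n, poissonMeasure a {n} = 1 := by
    have := lintegral_countable' (μ := poissonMeasure a) (fun _ => 1)
    simpa using this.symm
  rw [ENNReal.tsum_mul_left, hs]
  simp

/-- The σ-algebra is a parameter so that the one generated by the counts can be used, as needed to
transfer independence to the counting measures. -/
theorem measurable_countingMeasure {Ω : Type*} {m : MeasurableSpace Ω} {Φ : Ω → Set Plane}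
    (hΦ : ∀ (ω : Ω) (B : Set Plane), Bornology.IsBounded B → (Φ ω ∩ B).Finite)
    (hm : ∀ B : Set Plane, MeasurableSet B → Measurable[m] (numPoints Φ B)) :
    Measurable[m] fun ω => countingMeasure (Φ ω) := by
  refine Measure.measurable_of_measurable_coe _ fun B hB => ?_
  simp_rw [countingMeasure_apply (countable_of_finite_inter (hΦ _)) hB]
  exact (measurable_from_top (f := fun n : ℕ∞ => (n : ℝ≥0∞))).comp (hm B hB)

section PointProcess

variable {Ω : Type*} [MeasurableSpace Ω] {P : Measure Ω} {Φ : Ω → Set Plane} {r : ℝ≥0}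

theorem IsPointProcess.measurable_countingMeasure (hΦ : IsPointProcess Φ) :
    Measurable fun ω => countingMeasure (Φ ω) :=
  Network.measurable_countingMeasure hΦ.locallyFinite hΦ.measurable

theorem IsPointProcess.countable (hΦ : IsPointProcess Φ) (ω : Ω) : (Φ ω).Countable :=
  countable_of_finite_inter (hΦ.locallyFinite ω)

theorem IsPointProcess.countingMeasure_apply (hΦ : IsPointProcess Φ) (ω : Ω) {B : Set Plane}
    (hB : MeasurableSet B) : countingMeasure (Φ ω) B = (numPoints Φ B ω : ℝ≥0∞) :=
  Network.countingMeasure_apply (hΦ.countable ω) hB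

theorem IsPointProcess.locallyFinitePart_countingMeasure (hΦ : IsPointProcess Φ) (ω : Ω) :
    locallyFinitePart (countingMeasure (Φ ω)) = countingMeasure (Φ ω) :=
  locallyFinitePart_eq (countingMeasure_mem_locallyFinite (hΦ.locallyFinite ω))

theorem IsPointProcess.sFinite_countingMeasure (hΦ : IsPointProcess Φ) (ω : Ω) :
    SFinite (countingMeasure (Φ ω)) := by
  rw [← hΦ.locallyFinitePart_countingMeasure]
  infer_instance

theorem IsPointProcess.measurable_coe_numPoints (hΦ : IsPointProcess Φ) {B : Set Plane}
    (hB : MeasurableSet B) : Measurable fun ω => (numPoints Φ B ω : ℝ≥0∞) :=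
  (measurable_from_top (f := fun n : ℕ∞ => (n : ℝ≥0∞))).comp (hΦ.measurable B hB)

theorem IsPoissonProcess.lintegral_numPoints (hΦ : IsPoissonProcess Φ r P) {B : Set Plane}
    (hB : MeasurableSet B) (hB1 : volume B ≠ ∞) :
    ∫⁻ ω, (numPoints Φ B ω : ℝ≥0∞) ∂P = r * volume B := by
  have h := lintegral_map (μ := P) (f := fun n : ℕ∞ => (n : ℝ≥0∞)) measurable_from_top
    (hΦ.measurable B hB)
  rw [← h, hΦ.law B hB hB1, lintegral_map measurable_from_top measurable_from_top]
  simp only [ENat.toENNReal_coe]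
  rw [lintegral_natCast_poissonMeasure, ENNReal.coe_mul, ENNReal.coe_toNNReal hB1]

theorem IsPoissonProcess.measure_numPoints_ball (hΦ : IsPoissonProcess Φ r P) (z : Plane) (k : ℕ)
    {ρ : ℝ} (hρ : 0 ≤ ρ) :
    P {ω | numPoints Φ (Metric.ball z ρ) ω = k} = discMass r k ρ := by
  have hb : MeasurableSet (Metric.ball z ρ) := Metric.isOpen_ball.measurableSet
  have h := congrArg (fun μ => μ {(k : ℕ∞)}) (hΦ.law _ hb measure_ball_lt_top.ne)
  rw [Measure.map_apply (hΦ.measurable _ hb) (measurableSet_singleton _),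
    Measure.map_apply measurable_from_top (measurableSet_singleton _)] at h
  have hpre : (fun n : ℕ => (n : ℕ∞)) ⁻¹' {(k : ℕ∞)} = {k} := by
    ext n; simp
  rw [hpre, poissonMeasure_singleton] at h
  rw [show {ω | numPoints Φ (Metric.ball z ρ) ω = k} = numPoints Φ (Metric.ball z ρ) ⁻¹' {(k : ℕ∞)}
    from rfl, h, discMass]
  have hv : ((r * (volume (Metric.ball z ρ)).toNNReal : ℝ≥0) : ℝ) = r * (Real.pi * ρ ^ 2) := by
    have : (volume (Metric.ball z ρ)).toReal = Real.pi * ρ ^ 2 := by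
      rw [EuclideanSpace.volume_ball_fin_two]
      simp [hρ, Real.pi_pos.le, mul_comm]
    rw [NNReal.coe_mul, ← this]
    rfl
  rw [hv]

theorem IsPoissonProcess.lintegral_numPoints_mul_indicator (hΦ : IsPoissonProcess Φ r P)
    {B C : Set Plane} (hB : MeasurableSet B) (hC : MeasurableSet C) (hBC : Disjoint B C) (k : ℕ) :
    ∫⁻ ω, ({n : ℕ∞ | n = k}.indicator 1 (numPoints Φ C ω)) * (numPoints Φ B ω : ℝ≥0∞) ∂P =
      P {ω | numPoints Φ C ω = k} * ∫⁻ ω, (numPoints Φ B ω : ℝ≥0∞) ∂P := by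
  have hi := hΦ.indep 2 ![C, B] (by simp [Fin.forall_fin_two, hB, hC])
    (by
      intro i j hij
      fin_cases i <;> fin_cases j <;> simp_all [hBC.symm])
  have hi' : IndepFun (numPoints Φ C) (numPoints Φ B) P := by
    simpa using hi.indepFun (i := 0) (j := 1) (by simp)
  have hi'' := hi'.comp (φ := {n : ℕ∞ | n = k}.indicator (1 : ℕ∞ → ℝ≥0∞))
    (ψ := fun n : ℕ∞ => (n : ℝ≥0∞)) measurable_from_top measurable_from_top
  have := lintegral_mul_eq_lintegral_mul_lintegral_of_indepFun
    (measurable_from_top.comp (hΦ.measurable C hC))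
    (measurable_from_top.comp (hΦ.measurable B hB)) hi''
  simp only [Pi.mul_apply, Function.comp_apply] at this
  rw [this]
  congr 1
  exact lintegral_indicator_one (hΦ.measurable C hC (measurableSet_singleton (k : ℕ∞)))

end PointProcess

/-! ### A Mecke formula by discretization into annuli. -/

open Filter Topology

/-- The index of the annulus of width `1 / (m + 1)` around `z` that contains `x`. -/
noncomputable def annulusIndex (m : ℕ) (z x : Plane) : ℕ := ⌊dist x z * ((m : ℝ) + 1)⌋₊

theorem measurable_annulusIndex (m : ℕ) (z : Plane) : Measurable (annulusIndex m z) :=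
  Nat.measurable_floor.comp (by fun_prop)

theorem annulusIndex_div_le (m : ℕ) (z x : Plane) :
    (annulusIndex m z x : ℝ) / ((m : ℝ) + 1) ≤ dist x z :=
  (div_le_iff₀ (by positivity)).2 (Nat.floor_le (by positivity))

theorem tendsto_annulusIndex_div (z x : Plane) :
    Tendsto (fun m : ℕ => (annulusIndex m z x : ℝ) / ((m : ℝ) + 1)) atTop (𝓝 (dist x z)) :=
  (tendsto_nat_floor_mul_div_atTop dist_nonneg).comp
    (tendsto_natCast_atTop_atTop.atTop_add tendsto_const_nhds)

theorem setLIntegral_comp_nat {α : Type*} [MeasurableSpace α] (ν : Measure α) {B : Set α}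
    {f : α → ℕ} (hf : Measurable f) (c : ℕ → ℝ≥0∞) :
    ∫⁻ x in B, c (f x) ∂ν = ∑' j, c j * ν (B ∩ f ⁻¹' {j}) := by
  rw [← lintegral_map (μ := ν.restrict B) (f := c) measurable_from_top hf, lintegral_countable']
  refine tsum_congr fun j => ?_
  rw [Measure.map_apply hf (measurableSet_singleton _),
    Measure.restrict_apply (hf (measurableSet_singleton _)), Set.inter_comm]

/-- The sequence is eventually constant: the finitely many points of the open ball have distance
strictly below `d`, so balls with radii tending to `d` from below eventually contain them all. -/
theorem tendsto_indicator_encard_inter_ball {φ : Set Plane}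
    (hφ : ∀ B : Set Plane, Bornology.IsBounded B → (φ ∩ B).Finite) (k : ℕ) (z : Plane) {d : ℝ}
    {s : ℕ → ℝ} (hs : ∀ m, s m ≤ d) (hsd : Tendsto s atTop (𝓝 d)) :
    Tendsto (fun m => {n : ℕ∞ | n = k}.indicator (1 : ℕ∞ → ℝ≥0∞)
        (φ ∩ Metric.ball z (s m)).encard) atTop
      (𝓝 ({n : ℕ∞ | n = k}.indicator (1 : ℕ∞ → ℝ≥0∞) (φ ∩ Metric.ball z d).encard)) := by
  refine tendsto_const_nhds.congr' ?_
  have hfin : ∀ᶠ m in atTop, ∀ w ∈ φ ∩ Metric.ball z d, dist w z < s m :=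
    (hφ _ Metric.isBounded_ball).eventually_all.2 fun w hw => hsd.eventually_const_lt hw.2
  filter_upwards [hfin] with m hm
  congr 2
  exact Set.Subset.antisymm (fun w hw => ⟨hw.1, hm w hw⟩)
    (Set.inter_subset_inter_right _ (Metric.ball_subset_ball (hs m)))

section PointProcess

variable {Ω : Type*} [MeasurableSpace Ω] {P : Measure Ω} {Φ : Ω → Set Plane} {r : ℝ≥0}

theorem IsPointProcess.measurable_indicator_numPoints_mul (hΦ : IsPointProcess Φ)
    {B C : Set Plane} (hB : MeasurableSet B) (hC : MeasurableSet C) (k : ℕ) :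
    Measurable fun ω => {n : ℕ∞ | n = k}.indicator (1 : ℕ∞ → ℝ≥0∞) (numPoints Φ C ω) *
      (numPoints Φ B ω : ℝ≥0∞) :=
  ((measurable_from_top (f := {n : ℕ∞ | n = k}.indicator (1 : ℕ∞ → ℝ≥0∞))).comp
    (hΦ.measurable C hC)).mul (hΦ.measurable_coe_numPoints hB)

/-- Rounding the radius down makes it constant on each annulus and keeps the disc disjoint from the
annulus, so the counts in the two sets are independent and the expectation factorizes. -/
theorem IsPoissonProcess.lintegral_annulus (hΦ : IsPoissonProcess Φ r P) {B : Set Plane}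
    (hB : MeasurableSet B) (hB1 : volume B ≠ ∞) (k m : ℕ) (z : Plane) :
    ∫⁻ ω, ∫⁻ x in B, {n : ℕ∞ | n = k}.indicator (1 : ℕ∞ → ℝ≥0∞)
        (numPoints Φ (Metric.ball z ((annulusIndex m z x : ℝ) / ((m : ℝ) + 1))) ω)
        ∂countingMeasure (Φ ω) ∂P =
      ∫⁻ x in B, r * discMass r k ((annulusIndex m z x : ℝ) / ((m : ℝ) + 1)) := by
  have hi := measurable_annulusIndex m z
  have hS (j : ℕ) : MeasurableSet (B ∩ annulusIndex m z ⁻¹' {j}) :=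
    hB.inter (hi (measurableSet_singleton j))
  have hball (j : ℕ) : MeasurableSet (Metric.ball z ((j : ℝ) / ((m : ℝ) + 1))) :=
    Metric.isOpen_ball.measurableSet
  rw [setLIntegral_comp_nat (B := B) volume hi fun j => r * discMass r k ((j : ℝ) / ((m : ℝ) + 1))]
  have hω (ω : Ω) := setLIntegral_comp_nat (B := B) (countingMeasure (Φ ω)) hi fun j =>
    {n : ℕ∞ | n = k}.indicator (1 : ℕ∞ → ℝ≥0∞)
      (numPoints Φ (Metric.ball z ((j : ℝ) / ((m : ℝ) + 1))) ω)
  simp_rw [hω, hΦ.countingMeasure_apply _ (hS _)]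
  rw [lintegral_tsum fun j => (hΦ.measurable_indicator_numPoints_mul (hS j)
    (hball j) k).aemeasurable]
  refine tsum_congr fun j => ?_
  rw [hΦ.lintegral_numPoints_mul_indicator (hS j) (hball j), hΦ.measure_numPoints_ball z k (by
    positivity), hΦ.lintegral_numPoints (hS j) (measure_ne_top_of_subset Set.inter_subset_left hB1)]
  · ring
  · refine Set.disjoint_left.2 fun x hx hxb => (Metric.mem_ball.1 hxb).not_ge ?_
    rw [← show annulusIndex m z x = j from hx.2]
    exact annulusIndex_div_le m z x

theorem IsPoissonProcess.discMass_le_one [IsProbabilityMeasure P] (hΦ : IsPoissonProcess Φ r P)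
    (k : ℕ) {ρ : ℝ} (hρ : 0 ≤ ρ) : discMass r k ρ ≤ 1 := by
  rw [← hΦ.measure_numPoints_ball 0 k hρ]
  exact prob_le_one

/-- A Mecke formula for the number of stations of rank `k` with respect to `z`. -/
theorem IsPoissonProcess.lintegral_rankIndicator_station [IsProbabilityMeasure P]
    (hΦ : IsPoissonProcess Φ r P) {B : Set Plane} (hB : MeasurableSet B) (hB1 : volume B ≠ ∞)
    (k : ℕ) (z : Plane) :
    ∫⁻ ω, ∫⁻ x in B, rankIndicator k (countingMeasure (Φ ω), x, z) ∂countingMeasure (Φ ω) ∂P =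
      ∫⁻ x in B, r * discMass r k (dist x z) := by
  have hind : ∀ n : ℕ∞, {n : ℕ∞ | n = k}.indicator (1 : ℕ∞ → ℝ≥0∞) n ≤ 1 :=
    Set.indicator_le_self' (fun _ _ => zero_le_one)
  have hmi (m : ℕ) (ω : Ω) : Measurable fun x => {n : ℕ∞ | n = k}.indicator (1 : ℕ∞ → ℝ≥0∞)
      (numPoints Φ (Metric.ball z ((annulusIndex m z x : ℝ) / ((m : ℝ) + 1))) ω) :=
    (measurable_from_top (f := fun j : ℕ => {n : ℕ∞ | n = k}.indicator (1 : ℕ∞ → ℝ≥0∞)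
      (numPoints Φ (Metric.ball z ((j : ℝ) / ((m : ℝ) + 1))) ω))).comp
      (measurable_annulusIndex m z)
  have hEB : ∫⁻ ω, (numPoints Φ B ω : ℝ≥0∞) ∂P ≠ ∞ := by
    rw [hΦ.lintegral_numPoints hB hB1]
    finiteness
  -- `B` may be unbounded, so its number of points is finite only almost surely; this count
  -- dominates both the inner and the outer limit.
  have hfin : ∀ᵐ ω ∂P, (numPoints Φ B ω : ℝ≥0∞) < ∞ :=
    ae_lt_top (hΦ.measurable_coe_numPoints hB) hEB
  have hleft : Tendsto (fun m : ℕ => ∫⁻ ω, ∫⁻ x in B, {n : ℕ∞ | n = k}.indicator (1 : ℕ∞ → ℝ≥0∞)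
        (numPoints Φ (Metric.ball z ((annulusIndex m z x : ℝ) / ((m : ℝ) + 1))) ω)
        ∂countingMeasure (Φ ω) ∂P) atTop
      (𝓝 (∫⁻ ω, ∫⁻ x in B, rankIndicator k (countingMeasure (Φ ω), x, z)
        ∂countingMeasure (Φ ω) ∂P)) := by
    refine tendsto_lintegral_of_dominated_convergence (fun ω => (numPoints Φ B ω : ℝ≥0∞))
      (fun m => ?_) (fun m => Eventually.of_forall fun ω => ?_) hEB ?_
    · have hω (ω : Ω) := setLIntegral_comp_nat (B := B) (countingMeasure (Φ ω))
        (measurable_annulusIndex m z) fun j => {n : ℕ∞ | n = k}.indicator (1 : ℕ∞ → ℝ≥0∞)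
          (numPoints Φ (Metric.ball z ((j : ℝ) / ((m : ℝ) + 1))) ω)
      have hS (j : ℕ) : MeasurableSet (B ∩ annulusIndex m z ⁻¹' {j}) :=
        hB.inter (measurable_annulusIndex m z (measurableSet_singleton j))
      simp_rw [hω, hΦ.countingMeasure_apply _ (hS _)]
      exact Measurable.tsum fun j => hΦ.measurable_indicator_numPoints_mul (hS j)
        Metric.isOpen_ball.measurableSet k
    · refine (lintegral_mono fun x => hind _).trans ?_
      rw [setLIntegral_one, hΦ.countingMeasure_apply ω hB]
    · filter_upwards [hfin] with ω hω
      refine tendsto_lintegral_of_dominated_convergence (fun _ => 1) (hmi · ω)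
        (fun m => Eventually.of_forall fun x => hind _) ?_ (Eventually.of_forall fun x => ?_)
      · rw [setLIntegral_one, hΦ.countingMeasure_apply ω hB]
        exact hω.ne
      · rw [rankIndicator_countingMeasure (hΦ.locallyFinite ω)]
        exact tendsto_indicator_encard_inter_ball (hΦ.locallyFinite ω) k z
          (annulusIndex_div_le · z x) (tendsto_annulusIndex_div z x)
  have hright : Tendsto (fun m : ℕ => ∫⁻ x in B,
        r * discMass r k ((annulusIndex m z x : ℝ) / ((m : ℝ) + 1))) atTop
      (𝓝 (∫⁻ x in B, r * discMass r k (dist x z))) := by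
    refine tendsto_lintegral_of_dominated_convergence (fun _ => r) (fun m => ?_)
      (fun m => Eventually.of_forall fun x => ?_) ?_ (Eventually.of_forall fun x => ?_)
    · exact (measurable_from_top (f := fun j : ℕ =>
        r * discMass r k ((j : ℝ) / ((m : ℝ) + 1)))).comp (measurable_annulusIndex m z)
    · exact mul_le_of_le_one_right' (hΦ.discMass_le_one k (by positivity))
    · rw [setLIntegral_const]
      finiteness
    · exact ENNReal.Tendsto.const_mul (((continuous_discMass r k).tendsto _).comp
        (tendsto_annulusIndex_div z x)) (Or.inr ENNReal.coe_ne_top)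
  refine tendsto_nhds_unique hleft (hright.congr fun m => ?_)
  exact (hΦ.lintegral_annulus hB hB1 k m z).symm

theorem IsPointProcess.measurable_lintegral_rankIndicator (hΦ : IsPointProcess Φ) {B : Set Plane}
    (hB : MeasurableSet B) (k : ℕ) :
    Measurable fun p : Ω × Plane => ∫⁻ x in B, rankIndicator k (countingMeasure (Φ p.1), x, p.2)
      ∂countingMeasure (Φ p.1) := by
  simp_rw [← lintegral_indicator hB]
  have h := hΦ.measurable_countingMeasure
  have h' := measurable_lintegral_locallyFinitePart (α := Ω × Plane)
    (g := fun p => countingMeasure (Φ p.1)) (h.comp measurable_fst)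
    (f := fun p => B.indicator fun x => rankIndicator k (countingMeasure (Φ p.1), x, p.2))
    (Measurable.indicator (s := {q : (Ω × Plane) × Plane | q.2 ∈ B})
      (f := fun q => rankIndicator k (countingMeasure (Φ q.1.1), q.2, q.1.2))
      ((measurable_rankIndicator k).comp ((h.comp (measurable_fst.comp measurable_fst)).prodMk
        (measurable_snd.prodMk (measurable_snd.comp measurable_fst))))
      (measurable_snd hB))
  simpa only [hΦ.locallyFinitePart_countingMeasure] using h'

/-- The expected total area of the sets `rankCell k` of the stations in `B` is the area of `B`. -/
theorem IsPoissonProcess.lintegral_volume_rankCell [IsProbabilityMeasure P]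
    (hΦ : IsPoissonProcess Φ r P) (hr : 0 < r) {B : Set Plane} (hB : MeasurableSet B)
    (hB1 : volume B ≠ ∞) (k : ℕ) :
    ∫⁻ ω, ∫⁻ x in B, volume (rankCell k (Φ ω) x) ∂countingMeasure (Φ ω) ∂P = volume B := by
  have hs (ω : Ω) : SFinite (countingMeasure (Φ ω)) := hΦ.sFinite_countingMeasure ω
  calc ∫⁻ ω, ∫⁻ x in B, volume (rankCell k (Φ ω) x) ∂countingMeasure (Φ ω) ∂P
      = ∫⁻ ω, (∫⁻ z, ∫⁻ x in B, rankIndicator k (countingMeasure (Φ ω), x, z)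
          ∂countingMeasure (Φ ω)) ∂P := by
        refine lintegral_congr fun ω => ?_
        rw [lintegral_lintegral_swap (by fun_prop)]
        simp_rw [lintegral_rankIndicator (hΦ.locallyFinite ω)]
    _ = ∫⁻ z : Plane, ∫⁻ x in B, r * discMass r k (dist x z) := by
        rw [lintegral_lintegral_swap
          (hΦ.toIsPointProcess.measurable_lintegral_rankIndicator hB k).aemeasurable]
        simp_rw [hΦ.lintegral_rankIndicator_station hB hB1]
    _ = ∫⁻ x in B, ∫⁻ z : Plane, r * discMass r k (dist x z) := by
        refine lintegral_lintegral_swap (Measurable.aemeasurable ?_)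
        have := (continuous_discMass r k).measurable
        fun_prop
    _ = ∫⁻ x in B, 1 := by
        refine lintegral_congr fun x => ?_
        have := (continuous_discMass r k).measurable
        rw [lintegral_const_mul _ (by fun_prop)]
        simp_rw [dist_comm x, dist_eq_norm]
        rw [lintegral_sub_right_eq_self (fun z : Plane => discMass r k ‖z‖) x,
          lintegral_discMass_norm hr, ENNReal.mul_inv_cancel (by simpa using hr.ne')
            ENNReal.coe_ne_top]
    _ = volume B := setLIntegral_one B

/-- At most one point overall means none or one in every ball around the origin, and both
probabilities vanish as the radius grows. -/
theorem IsPoissonProcess.ae_nontrivial [IsProbabilityMeasure P] (hΦ : IsPoissonProcess Φ r P)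
    (hr : 0 < r) : ∀ᵐ ω ∂P, (Φ ω).Nontrivial := by
  have hlim (k : ℕ) : Tendsto (fun n : ℕ => discMass r k n) atTop (𝓝 0) := by
    have h1 : Tendsto (fun n : ℕ => (r : ℝ) * (Real.pi * (n : ℝ) ^ 2)) atTop atTop :=
      ((tendsto_pow_atTop two_ne_zero).comp tendsto_natCast_atTop_atTop).const_mul_atTop
        Real.pi_pos |>.const_mul_atTop (NNReal.coe_pos.2 hr)
    have h2 := ((Real.tendsto_pow_mul_exp_neg_atTop_nhds_zero k).comp h1).div_const
      (k.factorial : ℝ)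
    have h3 := (ENNReal.continuous_ofReal.tendsto _).comp h2
    rw [zero_div, ENNReal.ofReal_zero] at h3
    refine h3.congr fun n => ?_
    simp only [Function.comp_apply, discMass]
    rw [mul_comm (Real.exp _)]
  have hle (n : ℕ) : P {ω | ¬ (Φ ω).Nontrivial} ≤ discMass r 0 n + discMass r 1 n := by
    rw [← hΦ.measure_numPoints_ball 0 0 n.cast_nonneg, ← hΦ.measure_numPoints_ball 0 1 n.cast_nonneg]
    refine (measure_mono fun ω hω => ?_).trans (measure_union_le _ _)
    have h1 : numPoints Φ (Metric.ball 0 n) ω ≤ 1 :=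
      (Set.encard_le_encard Set.inter_subset_left).trans
        (Set.encard_le_one_iff_subsingleton.2 (Set.not_nontrivial_iff.1 hω))
    rcases h1.lt_or_eq with h | h
    · exact Or.inl (by simpa using h)
    · exact Or.inr (by simpa using h)
  have h0 := ge_of_tendsto' ((hlim 0).add (hlim 1)) hle
  rw [add_zero] at h0
  exact le_antisymm h0 zero_le

end PointProcess

/-! ### Mass transport -/

section Translation

variable {φ : Set Plane}

theorem finite_vadd_inter (hφ : ∀ B : Set Plane, Bornology.IsBounded B → (φ ∩ B).Finite)
    (v : Plane) (B : Set Plane) (hB : Bornology.IsBounded B) :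
    ((fun z => v + z) '' φ ∩ B).Finite := by
  rw [← Set.image_inter_preimage]
  refine (hφ _ ?_).image _
  obtain ⟨R, hR⟩ := hB.subset_closedBall v
  refine (Metric.isBounded_closedBall (x := 0) (r := R)).subset fun z hz => ?_
  simpa [dist_eq_norm] using hR hz

theorem rankCell_vadd (k : ℕ) (v x z : Plane) :
    v + z ∈ rankCell k ((fun z => v + z) '' φ) (v + x) ↔ z ∈ rankCell k φ x := by
  have hball : (fun z => v + z) ⁻¹' Metric.ball (v + z) (dist (v + x) (v + z)) =
      Metric.ball z (dist x z) := by
    ext w; simp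
  rw [rankCell, rankCell, Set.mem_ofPred_eq, Set.mem_ofPred_eq, ← Set.image_inter_preimage, hball,
    (add_right_injective v).encard_image]

theorem transport_countingMeasure_vadd {ψ : Set Plane}
    (hφ : ∀ B : Set Plane, Bornology.IsBounded B → (φ ∩ B).Finite)
    (hψ : ∀ B : Set Plane, Bornology.IsBounded B → (ψ ∩ B).Finite)
    (k : ℕ) {f g : Plane → ℝ≥0∞} (hf : Measurable f) (hg : Measurable g) (v : Plane) :
    transport k f g (countingMeasure ((fun z => v + z) '' φ),
        countingMeasure ((fun z => v + z) '' ψ)) =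
      transport k (fun x => f (v + x)) (fun z => g (v + z))
        (countingMeasure φ, countingMeasure ψ) := by
  have hm : Measurable fun z : Plane => v + z := measurable_const_add v
  have hF : Measurable fun q : Plane × Plane =>
      f q.1 * g q.2 * rankIndicator k (countingMeasure ((fun z => v + z) '' φ), q.1, q.2) := by
    fun_prop
  have hrank (x z : Plane) :
      rankIndicator k (countingMeasure ((fun z => v + z) '' φ), v + x, v + z) =
        rankIndicator k (countingMeasure φ, x, z) := by
    rw [rankIndicator_countingMeasure hφ, rankIndicator_countingMeasure (finite_vadd_inter hφ v)]
    by_cases h : z ∈ rankCell k φ x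
    · rw [Set.indicator_of_mem h, Set.indicator_of_mem ((rankCell_vadd k v x z).2 h)]
      rfl
    · rw [Set.indicator_of_notMem h, Set.indicator_of_notMem ((rankCell_vadd k v x z).not.2 h)]
  unfold transport
  simp only
  rw [locallyFinitePart_eq (countingMeasure_mem_locallyFinite hφ),
    locallyFinitePart_eq (countingMeasure_mem_locallyFinite hψ),
    locallyFinitePart_eq (countingMeasure_mem_locallyFinite (finite_vadd_inter hφ v)),
    locallyFinitePart_eq (countingMeasure_mem_locallyFinite (finite_vadd_inter hψ v))]
  have hs : SFinite (countingMeasure ((fun z => v + z) '' ψ)) := by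
    rw [← locallyFinitePart_eq (countingMeasure_mem_locallyFinite (finite_vadd_inter hψ v))]
    infer_instance
  have hF' := hF.lintegral_prod_right' (ν := countingMeasure ((fun z => v + z) '' ψ))
  rw [map_countingMeasure_vadd (countable_of_finite_inter hφ), lintegral_map ?_ hm]
  · refine lintegral_congr fun x => ?_
    rw [map_countingMeasure_vadd (countable_of_finite_inter hψ), lintegral_map ?_ hm]
    · rw [← map_countingMeasure_vadd (countable_of_finite_inter hφ)]
      simp_rw [hrank]
    · fun_prop
  · rw [← map_countingMeasure_vadd (countable_of_finite_inter hφ)]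
    exact hF'

end Translation

section PointProcess

variable {Ω : Type*} [MeasurableSpace Ω] {P : Measure Ω} {Φ Ψ : Ω → Set Plane}

theorem JointlyStationary.lintegral_transport (h : JointlyStationary Φ Ψ P)
    (hΦ : IsPointProcess Φ) (hΨ : IsPointProcess Ψ) (k : ℕ) {f g : Plane → ℝ≥0∞}
    (hf : Measurable f) (hg : Measurable g) (v : Plane) :
    ∫⁻ ω, transport k (fun x => f (v + x)) (fun z => g (v + z))
        (countingMeasure (Φ ω), countingMeasure (Ψ ω)) ∂P =
      ∫⁻ ω, transport k f g (countingMeasure (Φ ω), countingMeasure (Ψ ω)) ∂P := by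
  have hT : Measurable (transport k f g) :=
    measurable_transport k (f := fun _ => f) (g := fun _ => g) (by fun_prop) (by fun_prop)
      measurable_id
  have := ((h v).comp hT).lintegral_eq
  simp only [Function.comp_apply] at this
  rw [← this]
  refine lintegral_congr fun ω => ?_
  rw [transport_countingMeasure_vadd (hΦ.locallyFinite ω) (hΨ.locallyFinite ω) k hf hg]

/-- The quantity compared is the transport from `B` to a translate of `B`, integrated over all
translations. Integrating the user's window away gives `volume B` times the left side; after
shifting both processes back, integrating the station's window away gives `volume B` times the right
side. Cancelling needs `0 < volume B < ∞`, but neither side has to be finite. -/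
theorem JointlyStationary.mass_transport [SFinite P] (h : JointlyStationary Φ Ψ P)
    (hΦ : IsPointProcess Φ) (hΨ : IsPointProcess Ψ) (k : ℕ) {B : Set Plane}
    (hB : MeasurableSet B) (hB0 : volume B ≠ 0) (hB1 : volume B ≠ ∞) :
    ∫⁻ ω, transport k (B.indicator 1) 1 (countingMeasure (Φ ω), countingMeasure (Ψ ω)) ∂P =
      ∫⁻ ω, transport k 1 (B.indicator 1) (countingMeasure (Φ ω), countingMeasure (Ψ ω)) ∂P := by
  set b : Plane → ℝ≥0∞ := B.indicator 1 with hb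
  have hbm : Measurable b := measurable_one.indicator hB
  have hp : Measurable fun ω => (countingMeasure (Φ ω), countingMeasure (Ψ ω)) :=
    hΦ.measurable_countingMeasure.prodMk hΨ.measurable_countingMeasure
  have hbv : ∫⁻ v, b v = volume B := lintegral_indicator_one hB
  have hbadd (z : Plane) : ∫⁻ v, b (v + z) = volume B := by
    rw [lintegral_add_right_eq_self b z, hbv]
  have hbneg (x : Plane) : ∫⁻ v, b (-v + x) = volume B := by
    rw [lintegral_neg_eq_self (fun v => b (v + x)), hbadd]
  have hconst (p : Measure Plane × Measure Plane) (f g : Plane → ℝ≥0∞) (hf : Measurable f)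
      (hg : Measurable g) (c : ℝ≥0∞) :
      ∫⁻ x, ∫⁻ z, (c * (f x * g z)) * rankIndicator k (p.1, x, z) ∂locallyFinitePart p.2
        ∂locallyFinitePart p.1 = c * transport k f g p := by
    unfold transport
    rw [← lintegral_const_mul _ (Measurable.lintegral_prod_right' (f := fun q : Plane × Plane =>
      f q.1 * g q.2 * rankIndicator k (p.1, q.1, q.2)) (by fun_prop))]
    refine lintegral_congr fun x => ?_
    rw [← lintegral_const_mul _ (by fun_prop)]
    simp_rw [mul_assoc]
  have hleft : ∫⁻ v, ∫⁻ ω, transport k b (fun z => b (v + z))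
      (countingMeasure (Φ ω), countingMeasure (Ψ ω)) ∂P =
      volume B * ∫⁻ ω, transport k b 1 (countingMeasure (Φ ω), countingMeasure (Ψ ω)) ∂P := by
    rw [lintegral_lintegral_swap]
    · rw [← lintegral_const_mul _ (measurable_transport k (f := fun _ => b) (g := fun _ => 1)
        (by fun_prop) (by fun_prop) hp)]
      refine lintegral_congr fun ω => ?_
      rw [Network.lintegral_transport k (f := fun _ => b) (g := fun v z => b (v + z))
        (by fun_prop) (by fun_prop), ← hconst _ b 1 hbm measurable_one]
      refine lintegral_congr fun x => lintegral_congr fun z => ?_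
      rw [lintegral_const_mul _ (by fun_prop), hbadd, Pi.one_apply, mul_one, mul_comm (b x)]
    · exact (measurable_transport k (f := fun _ : Plane × Ω => b)
        (g := fun q z => b (q.1 + z)) (by fun_prop) (by fun_prop)
        (hp.comp measurable_snd)).aemeasurable
  have hright : ∫⁻ v, ∫⁻ ω, transport k (fun x => b (-v + x)) b
      (countingMeasure (Φ ω), countingMeasure (Ψ ω)) ∂P =
      volume B * ∫⁻ ω, transport k 1 b (countingMeasure (Φ ω), countingMeasure (Ψ ω)) ∂P := by
    rw [lintegral_lintegral_swap]
    · rw [← lintegral_const_mul _ (measurable_transport k (f := fun _ => 1) (g := fun _ => b)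
        (by fun_prop) (by fun_prop) hp)]
      refine lintegral_congr fun ω => ?_
      rw [Network.lintegral_transport k (f := fun v x => b (-v + x)) (g := fun _ => b)
        (by fun_prop) (by fun_prop), ← hconst _ 1 b measurable_one hbm]
      refine lintegral_congr fun x => lintegral_congr fun z => ?_
      rw [lintegral_mul_const _ (by fun_prop), hbneg, Pi.one_apply, one_mul]
    · exact (measurable_transport k (f := fun (q : Plane × Ω) x => b (-q.1 + x))
        (g := fun _ => b) (by fun_prop) (by fun_prop)
        (hp.comp measurable_snd)).aemeasurable
  have hshift (v : Plane) : ∫⁻ ω, transport k b (fun z => b (v + z))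
      (countingMeasure (Φ ω), countingMeasure (Ψ ω)) ∂P =
      ∫⁻ ω, transport k (fun x => b (-v + x)) b
      (countingMeasure (Φ ω), countingMeasure (Ψ ω)) ∂P := by
    rw [← h.lintegral_transport hΦ hΨ k hbm (by fun_prop : Measurable fun z => b (v + z)) (-v)]
    simp_rw [add_neg_cancel_left]
  simp_rw [hshift] at hleft
  exact (ENNReal.mul_right_inj hB0 hB1).1 (hleft.symm.trans hright)

theorem transport_indicator_one (hΦ : IsPointProcess Φ) (hΨ : IsPointProcess Ψ) (k : ℕ)
    {B : Set Plane} (hB : MeasurableSet B) (ω ω' : Ω) :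
    transport k (B.indicator 1) 1 (countingMeasure (Φ ω), countingMeasure (Ψ ω')) =
      ∫⁻ x in B, countingMeasure (Ψ ω') (rankCell k (Φ ω) x) ∂countingMeasure (Φ ω) := by
  unfold transport
  simp only
  rw [hΦ.locallyFinitePart_countingMeasure, hΨ.locallyFinitePart_countingMeasure,
    ← lintegral_indicator hB]
  refine lintegral_congr fun x => ?_
  have := lintegral_rankIndicator (hΦ.locallyFinite ω) k x (countingMeasure (Ψ ω'))
  by_cases hx : x ∈ B <;> simp [hx, this]

theorem transport_one_indicator (hΦ : IsPointProcess Φ) (hΨ : IsPointProcess Ψ) {k : ℕ}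
    (hk : k ≤ 1) {B : Set Plane} (hB : MeasurableSet B) {ω : Ω} (hnt : (Φ ω).Nontrivial)
    (hties : ∀ z ∈ Ψ ω, Set.InjOn (fun x => ‖z - x‖) (Φ ω)) :
    transport k 1 (B.indicator 1) (countingMeasure (Φ ω), countingMeasure (Ψ ω)) =
      countingMeasure (Ψ ω) B := by
  have := hΦ.sFinite_countingMeasure ω
  have := hΨ.sFinite_countingMeasure ω
  have hb : Measurable (B.indicator (1 : Plane → ℝ≥0∞)) := measurable_one.indicator hB
  unfold transport
  simp only
  rw [hΦ.locallyFinitePart_countingMeasure, hΨ.locallyFinitePart_countingMeasure,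
    lintegral_lintegral_swap (by fun_prop), ← lintegral_indicator_one hB]
  have hae : ∀ᵐ z ∂countingMeasure (Ψ ω), z ∈ Ψ ω :=
    ae_restrict_mem (hΨ.countable ω).measurableSet
  refine lintegral_congr_ae ?_
  filter_upwards [hae] with z hz
  simp only [Pi.one_apply, one_mul]
  rw [lintegral_const_mul _ (by fun_prop),
    lintegral_rankIndicator_station (hΦ.locallyFinite ω) hnt (hties z hz) hk, mul_one]

/-- The Poisson law is prescribed only on sets of finite area, whereas a rank set of a fixed
configuration may have infinite area; exhaustion by balls and monotone convergence bridge the gap.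
-/
theorem IsPoissonProcess.lintegral_countingMeasure {r : ℝ≥0} (hΨ : IsPoissonProcess Ψ r P)
    {A : Set Plane} (hA : MeasurableSet A) :
    ∫⁻ ω, countingMeasure (Ψ ω) A ∂P = r * volume A := by
  have hU : ⋃ n : ℕ, A ∩ Metric.ball 0 n = A := by
    rw [← Set.inter_iUnion, Metric.iUnion_ball_nat, Set.inter_univ]
  have hmono : Monotone fun n : ℕ => A ∩ Metric.ball (0 : Plane) n := fun m n h =>
    Set.inter_subset_inter_right _ (Metric.ball_subset_ball (by exact_mod_cast h))
  have hm (n : ℕ) : MeasurableSet (A ∩ Metric.ball (0 : Plane) n) :=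
    hA.inter Metric.isOpen_ball.measurableSet
  have hsup (μ : Measure Plane) : μ A = ⨆ n : ℕ, μ (A ∩ Metric.ball 0 n) := by
    rw [← hmono.measure_iUnion, hU]
  simp_rw [fun ω => hsup (countingMeasure (Ψ ω))]
  rw [hsup volume, ENNReal.mul_iSup, lintegral_iSup
    (f := fun n ω => countingMeasure (Ψ ω) (A ∩ Metric.ball 0 (n : ℕ)))
    (fun n => (Measure.measurable_coe (hm n)).comp hΨ.measurable_countingMeasure)
    fun m n h ω => measure_mono (hmono h)]
  refine iSup_congr fun n => ?_
  simp_rw [hΨ.countingMeasure_apply _ (hm n)]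
  exact hΨ.lintegral_numPoints (hm n)
    (measure_ne_top_of_subset Set.inter_subset_right measure_ball_lt_top.ne)

theorem Independent.indepFun_countingMeasure (h : Independent Φ Ψ P) (hΦ : IsPointProcess Φ)
    (hΨ : IsPointProcess Ψ) :
    IndepFun (fun ω => countingMeasure (Φ ω)) (fun ω => countingMeasure (Ψ ω)) P := by
  have hle (Θ : Ω → Set Plane) (hΘ : IsPointProcess Θ) :
      MeasurableSpace.comap (fun ω => countingMeasure (Θ ω)) inferInstance ≤ sigmaAlgebra Θ := by
    refine Measurable.comap_le (Network.measurable_countingMeasure hΘ.locallyFinite fun B hB => ?_)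
    refine Measurable.mono (comap_measurable (numPoints Θ B)) ?_ le_rfl
    exact le_iSup₂_of_le B hB le_rfl
  exact (IndepFun_iff_Indep _ _ _).2 (indep_of_indep_of_le_left
    (indep_of_indep_of_le_right h (hle Ψ hΨ)) (hle Φ hΦ))

/-- The users of an independent Poisson process see the sets `rankCell k` through their areas. -/
theorem IsPoissonProcess.lintegral_countingMeasure_rankCell [IsProbabilityMeasure P] {r : ℝ≥0}
    (hΨ : IsPoissonProcess Ψ r P) (hΦ : IsPointProcess Φ) (h : Independent Φ Ψ P) (k : ℕ)
    {B : Set Plane} (hB : MeasurableSet B) :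
    ∫⁻ ω, ∫⁻ x in B, countingMeasure (Ψ ω) (rankCell k (Φ ω) x) ∂countingMeasure (Φ ω) ∂P =
      r * ∫⁻ ω, ∫⁻ x in B, volume (rankCell k (Φ ω) x) ∂countingMeasure (Φ ω) ∂P := by
  have hb : Measurable (B.indicator (1 : Plane → ℝ≥0∞)) := measurable_one.indicator hB
  have hN := hΦ.measurable_countingMeasure
  have hM := hΨ.measurable_countingMeasure
  have hT : Measurable (transport k (B.indicator 1) 1) :=
    measurable_transport k (f := fun _ => B.indicator 1) (g := fun _ => 1) (by fun_prop)
      (by fun_prop) measurable_id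
  have hprod := (indepFun_iff_map_prod_eq_prod_map_map hN.aemeasurable hM.aemeasurable).1
    (h.indepFun_countingMeasure hΦ hΨ.toIsPointProcess)
  -- With the stations frozen at `ω`, only the users are averaged.
  have hinner (ω : Ω) :
      ∫⁻ ω', ∫⁻ x in B, countingMeasure (Ψ ω') (rankCell k (Φ ω) x) ∂countingMeasure (Φ ω) ∂P =
        r * ∫⁻ x in B, volume (rankCell k (Φ ω) x) ∂countingMeasure (Φ ω) := by
    have := hΦ.sFinite_countingMeasure ω
    rw [lintegral_lintegral_swap]
    · simp_rw [hΨ.lintegral_countingMeasure (measurableSet_rankCell (hΦ.locallyFinite ω) k _)]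
      simp_rw [← lintegral_rankIndicator (hΦ.locallyFinite ω)]
      rw [lintegral_const_mul _ (Measurable.lintegral_prod_right' (f := fun q : Plane × Plane =>
        rankIndicator k (countingMeasure (Φ ω), q.1, q.2)) (by fun_prop))]
    · have := measurable_lintegral_locallyFinitePart (α := Ω × Plane)
        (g := fun q => countingMeasure (Ψ q.1)) (hM.comp measurable_fst)
        (f := fun q z => rankIndicator k (countingMeasure (Φ ω), q.2, z)) (by fun_prop)
      simp_rw [hΨ.locallyFinitePart_countingMeasure,
        lintegral_rankIndicator (hΦ.locallyFinite ω)] at this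
      exact this.aemeasurable
  calc _ = ∫⁻ ω, transport k (B.indicator 1) 1
          (countingMeasure (Φ ω), countingMeasure (Ψ ω)) ∂P := by
        simp_rw [transport_indicator_one hΦ hΨ.toIsPointProcess k hB]
    _ = ∫⁻ p, transport k (B.indicator 1) 1 p
          ∂(P.map fun ω => countingMeasure (Φ ω)).prod (P.map fun ω => countingMeasure (Ψ ω)) := by
        rw [← hprod, lintegral_map hT (hN.prodMk hM)]
    _ = ∫⁻ ω, ∫⁻ ω', transport k (B.indicator 1) 1
          (countingMeasure (Φ ω), countingMeasure (Ψ ω')) ∂P ∂P := by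
        have := Measure.isProbabilityMeasure_map (μ := P) hM.aemeasurable
        rw [lintegral_prod _ hT.aemeasurable, lintegral_map hT.lintegral_prod_right' hN]
        refine lintegral_congr fun ω => lintegral_map (by fun_prop) hM
    _ = _ := by
        simp_rw [transport_indicator_one hΦ hΨ.toIsPointProcess k hB, hinner]
        exact lintegral_const_mul' _ _ ENNReal.coe_ne_top

end PointProcess

/-! ### Palm means -/

section PointProcess

variable {Ω : Type*} [MeasurableSpace Ω] {P : Measure Ω} {Φ Ψ : Ω → Set Plane}

theorem palmMean_eq (hΦ : IsPointProcess Φ) {B : Set Plane} (hB : MeasurableSet B)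
    (f : Ω → Plane → ℝ≥0∞) :
    palmMean P Φ B f = (∫⁻ ω, ∫⁻ x in B, f ω x ∂countingMeasure (Φ ω) ∂P) /
      ∫⁻ ω, (numPoints Φ B ω : ℝ≥0∞) ∂P := by
  simp_rw [palmMean, setLIntegral_countingMeasure (hΦ.countable _) hB]

/-- Serves to discard the null event of fewer than two stations, where the descriptions by ranks can
fail. -/
theorem palmMean_congr_ae {B : Set Plane} {f g : Ω → Plane → ℝ≥0∞}
    (h : ∀ᵐ ω ∂P, ∀ x ∈ Φ ω, f ω x = g ω x) : palmMean P Φ B f = palmMean P Φ B g := by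
  rw [palmMean, palmMean]
  congr 1
  refine lintegral_congr_ae ?_
  filter_upwards [h] with ω hω
  exact tsum_congr fun x => hω x x.2.1

theorem coe_numUsers (hΦ : IsPointProcess Φ) (hΨ : IsPointProcess Ψ) (ω : Ω) (x : Plane) :
    (numUsers Φ Ψ ω x : ℝ≥0∞) = countingMeasure (Ψ ω) (rankCell 0 (Φ ω) x) := by
  rw [numUsers, cell_eq_rankCell, Network.countingMeasure_apply (hΨ.countable ω)
    (measurableSet_rankCell (hΦ.locallyFinite ω) 0 x)]

theorem coe_numNeighbors (hΦ : IsPointProcess Φ) (hΨ : IsPointProcess Ψ) {ω : Ω}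
    (hnt : (Φ ω).Nontrivial) (x : Plane) :
    (numNeighbors Φ Ψ ω x : ℝ≥0∞) = countingMeasure (Ψ ω) (rankCell 1 (Φ ω) x) := by
  rw [numNeighbors, neighborhood_eq_rankCell (hΦ.locallyFinite ω) hnt,
    Network.countingMeasure_apply (hΨ.countable ω)
      (measurableSet_rankCell (hΦ.locallyFinite ω) 1 x)]

theorem volume_extendedCell (hΦ : IsPointProcess Φ) {ω : Ω} (hnt : (Φ ω).Nontrivial) (x : Plane) :
    volume (extendedCell (Φ ω) x) =
      volume (rankCell 0 (Φ ω) x) + volume (rankCell 1 (Φ ω) x) := by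
  rw [extendedCell_eq_union (hΦ.locallyFinite ω) hnt, measure_union
    (disjoint_rankCell zero_ne_one _ _) (measurableSet_rankCell (hΦ.locallyFinite ω) 1 x)]

theorem IsPointProcess.measurable_volume_rankCell (hΦ : IsPointProcess Φ) (k : ℕ) (ω : Ω) :
    Measurable fun x => volume (rankCell k (Φ ω) x) := by
  simp_rw [← lintegral_rankIndicator (hΦ.locallyFinite ω)]
  exact Measurable.lintegral_prod_right' (f := fun q : Plane × Plane =>
    rankIndicator k (countingMeasure (Φ ω), q.1, q.2)) (by fun_prop)

theorem IsPointProcess.measurable_lintegral_volume_rankCell (hΦ : IsPointProcess Φ) {B : Set Plane}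
    (hB : MeasurableSet B) (k : ℕ) :
    Measurable fun ω => ∫⁻ x in B, volume (rankCell k (Φ ω) x) ∂countingMeasure (Φ ω) := by
  have h (ω : Ω) : ∫⁻ x in B, volume (rankCell k (Φ ω) x) ∂countingMeasure (Φ ω) =
      ∫⁻ z, ∫⁻ x in B, rankIndicator k (countingMeasure (Φ ω), x, z) ∂countingMeasure (Φ ω) := by
    have := hΦ.sFinite_countingMeasure ω
    simp_rw [← lintegral_rankIndicator (hΦ.locallyFinite ω)]
    rw [lintegral_lintegral_swap (by fun_prop)]
  simp_rw [h]
  exact (hΦ.measurable_lintegral_rankIndicator hB k).lintegral_prod_right'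

end PointProcess

end Network

/-! ### Areas and user counts of the typical station. -/

theorem proposition1 {Ω : Type*} [MeasurableSpace Ω] (P : Measure Ω) [IsProbabilityMeasure P]
    (Φ : Ω → Set Plane) (r : ℝ≥0) (hr : 0 < r) (hΦ : Network.IsPoissonProcess Φ r P)
    (B : Set Plane) (hB : MeasurableSet B) (hB0 : volume B ≠ 0) (hB1 : volume B ≠ ∞) :
    -- the mean areas of the cell and of the extended cell of the typical base station
    (Network.palmMean P Φ B (fun ω x => volume (Network.cell (Φ ω) x)) = (r : ℝ≥0∞)⁻¹ ∧
      Network.palmMean P Φ B (fun ω x => volume (Network.extendedCell (Φ ω) x)) =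
        2 * Network.palmMean P Φ B (fun ω x => volume (Network.cell (Φ ω) x))) ∧
    -- users forming an independent Poisson process, with `K = ru / r` users per cell on average
    (∀ (Ψ : Ω → Set Plane) (ru : ℝ≥0), Network.IsPoissonProcess Ψ ru P →
      Network.Independent Φ Ψ P →
        Network.palmMean P Φ B (fun ω x => (Network.numUsers Φ Ψ ω x : ℝ≥0∞)) =
            (ru : ℝ≥0∞) / r ∧
          Network.palmMean P Φ B (fun ω x => (Network.numNeighbors Φ Ψ ω x : ℝ≥0∞)) =
            (ru : ℝ≥0∞) / r) ∧
    -- users scheduled in a stationary way, in particular exactly `K` of them in each cell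
    (∀ Ψ : Ω → Set Plane, Network.IsPointProcess Ψ → Network.JointlyStationary Φ Ψ P →
      (∀ᵐ ω ∂P, ∀ z ∈ Ψ ω, Set.InjOn (fun x => ‖z - x‖) (Φ ω)) →
        Network.palmMean P Φ B (fun ω x => (Network.numNeighbors Φ Ψ ω x : ℝ≥0∞)) =
            Network.palmMean P Φ B (fun ω x => (Network.numUsers Φ Ψ ω x : ℝ≥0∞)) ∧
          ∀ K : ℕ, (∀ᵐ ω ∂P, ∀ x ∈ Φ ω, Network.numUsers Φ Ψ ω x = K) →
            Network.palmMean P Φ B (fun ω x => (Network.numNeighbors Φ Ψ ω x : ℝ≥0∞)) = K) := by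
  have hPΦ := hΦ.toIsPointProcess
  have hEB : ∫⁻ ω, (Network.numPoints Φ B ω : ℝ≥0∞) ∂P = r * volume B :=
    hΦ.lintegral_numPoints hB hB1
  have hr0 : (r : ℝ≥0∞) ≠ 0 := by simpa using hr.ne'
  have hnt := hΦ.ae_nontrivial hr
  have hdiv (c : ℝ≥0∞) : c * volume B / (r * volume B) = c / r :=
    ENNReal.mul_div_mul_right _ _ hB0 hB1
  have hvol (k : ℕ) := hΦ.lintegral_volume_rankCell hr hB hB1 k
  have hcell : Network.palmMean P Φ B (fun ω x => volume (Network.cell (Φ ω) x)) =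
      (r : ℝ≥0∞)⁻¹ := by
    simp_rw [Network.palmMean_eq hPΦ hB, Network.cell_eq_rankCell]
    rw [hvol, hEB]
    simpa using hdiv 1
  have hneighbors (Ψ : Ω → Set Plane) (hΨ : Network.IsPointProcess Ψ) :
      Network.palmMean P Φ B (fun ω x => (Network.numNeighbors Φ Ψ ω x : ℝ≥0∞)) =
        (∫⁻ ω, ∫⁻ x in B, Network.countingMeasure (Ψ ω) (Network.rankCell 1 (Φ ω) x)
          ∂Network.countingMeasure (Φ ω) ∂P) / (r * volume B) := by
    rw [← hEB, ← Network.palmMean_eq hPΦ hB]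
    exact Network.palmMean_congr_ae (hnt.mono fun ω hω x _ =>
      Network.coe_numNeighbors hPΦ hΨ hω x)
  have husers (Ψ : Ω → Set Plane) (hΨ : Network.IsPointProcess Ψ) :
      Network.palmMean P Φ B (fun ω x => (Network.numUsers Φ Ψ ω x : ℝ≥0∞)) =
        (∫⁻ ω, ∫⁻ x in B, Network.countingMeasure (Ψ ω) (Network.rankCell 0 (Φ ω) x)
          ∂Network.countingMeasure (Φ ω) ∂P) / (r * volume B) := by
    rw [← hEB, ← Network.palmMean_eq hPΦ hB]
    simp_rw [Network.coe_numUsers hPΦ hΨ]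
  refine ⟨⟨hcell, ?_⟩, fun Ψ ru hΨ hind => ?_, fun Ψ hΨ hst hties => ?_⟩
  · rw [hcell, Network.palmMean_congr_ae (hnt.mono fun ω hω x _ =>
      Network.volume_extendedCell hPΦ hω x), Network.palmMean_eq hPΦ hB, hEB]
    simp_rw [fun ω => lintegral_add_left (μ := (Network.countingMeasure (Φ ω)).restrict B)
      (hPΦ.measurable_volume_rankCell 0 ω) fun x => volume (Network.rankCell 1 (Φ ω) x)]
    rw [lintegral_add_left (hPΦ.measurable_lintegral_volume_rankCell hB 0), hvol, hvol, ← two_mul,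
      hdiv, ENNReal.div_eq_inv_mul, mul_comm]
  · have hPΨ := hΨ.toIsPointProcess
    rw [husers Ψ hPΨ, hneighbors Ψ hPΨ, hΨ.lintegral_countingMeasure_rankCell hPΦ hind 0 hB,
      hΨ.lintegral_countingMeasure_rankCell hPΦ hind 1 hB, hvol, hvol]
    exact ⟨hdiv _, hdiv _⟩
  -- The right side does not involve `k`: each user in `B` is counted once for either rank.
  · have hmass (k : ℕ) (hk : k ≤ 1) :
        ∫⁻ ω, ∫⁻ x in B, Network.countingMeasure (Ψ ω) (Network.rankCell k (Φ ω) x)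
          ∂Network.countingMeasure (Φ ω) ∂P = ∫⁻ ω, Network.countingMeasure (Ψ ω) B ∂P := by
      simp_rw [← Network.transport_indicator_one hPΦ hΨ k hB]
      rw [hst.mass_transport hPΦ hΨ k hB hB0 hB1]
      refine lintegral_congr_ae ?_
      filter_upwards [hnt, hties] with ω h1 h2
      exact Network.transport_one_indicator hPΦ hΨ hk hB h1 h2
    have heq : Network.palmMean P Φ B (fun ω x => (Network.numNeighbors Φ Ψ ω x : ℝ≥0∞)) =
        Network.palmMean P Φ B (fun ω x => (Network.numUsers Φ Ψ ω x : ℝ≥0∞)) := by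
      rw [hneighbors Ψ hΨ, husers Ψ hΨ, hmass 0 zero_le_one, hmass 1 le_rfl]
    refine ⟨heq, fun K hK => ?_⟩
    rw [heq, Network.palmMean_congr_ae (g := fun _ _ => (K : ℝ≥0∞))
      (hK.mono fun ω hω x hx => by rw [hω x hx]; simp), Network.palmMean_eq hPΦ hB]
    simp_rw [setLIntegral_const, hPΦ.countingMeasure_apply _ hB]
    rw [lintegral_const_mul _ (hPΦ.measurable_coe_numPoints hB), hEB]
    exact ENNReal.mul_div_cancel_right (mul_ne_zero hr0 hB0)
      (ENNReal.mul_ne_top ENNReal.coe_ne_top hB1)
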